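/- For $k\ge 1$ let $N_k\in\mathbb{R}^{k\times k}$ be the nilpotent shift matrix with ones on the first superdiagonal and zeros elsewhere. For a square complex matrix $B$ having no eigenvalue in $\mathbb{Z}_{\le 0}=\{0,-1,-2,\dots\}$, let $\Gamma(B)$ be the gamma function of $B$ in the sense of primary matrix functions: $\Gamma(B)=P(B)$ for any polynomial $P$ such that $P^{(j)}(z)=\Gamma^{(j)}(z)$ for every eigenvalue $z$ of $B$ and every $0\le j<m_z$, where $m_z$ is the multiplicity of $z$ as a root of the minimal polynomial of $B$. For $p\in\{1,2,3,\dots\}\cup\{\infty\}$ let $\|\cdot\|_p$ be the matrix norm induced by the vector $p$-norm, and for $\alpha>0$ let $$\omega(\alpha):=\frac{2\alpha+1}{\alpha^2(\alpha+1)^2}+\frac{\cosh(1)-1}{(\alpha+2)^2}.$$ **Theorem.** Let $p\in\{1,2,3,\dots\}\cup\{\infty\}$, let $s\ge1$ and $n_1,\dots,n_s\ge 1$ be integers, $d:=n_1+\dots+n_s$, and let $M:=\mathrm{diag}(N_{n_1},\dots,N_{n_s})\in\mathbb{R}^{d\times d}$. Let $\hat\lambda\in\mathbb{C}$, let $Q\in\mathbb{C}^{d\times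 d}$, and let $R\in\mathbb{R}^{d\times d}$ have nonnegative entries and satisfy $|Q|\le R$, that is, $|Q_{ij}|\le R_{ij}$ for all $i,j$. Suppose $\mathrm{Re}(\hat\lambda)-\|M+R\|_p>0$ and define $$\delta_p:=\|R\|_p\Big(\Gamma'\big(\mathrm{Re}(\hat\lambda)+\|M+R\|_p\big)+\omega\big(\mathrm{Re}(\hat\lambda)+\|M+R\|_p\big)+\omega\big(\mathrm{Re}(\hat\lambda)-\|M+R\|_p\big)\Big).$$ Then neither $\hat\lambda I+M+Q$ nor $\hat\lambda I+M$ has an eigenvalue in $\mathbb{Z}_{\le 0}$ (so that both gamma matrices below are defined), and $$\big\|\Gamma(\hat\lambda I+M+Q)-\Gamma(\hat\lambda I+M)\big\|_p\le\delta_p,$$ with strict inequality whenever $R\ne 0$. -/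

import Mathlib

open scoped ENNReal BigOperators Polynomial

noncomputable section

namespace MatGamma

/-- `P` interpolates `f` in the sense of Hermite on the spectrum of `A`: at every eigenvalue `z`
of `A` the derivatives of `P` of orders `0, …, m - 1` are those of `f`, where `m` is the
multiplicity of `z` as a root of the minimal polynomial of `A` (the index of `z`). -/
def HermiteInterpolates {ι : Type*} [Fintype ι] [DecidableEq ι]
    (f : ℂ → ℂ) (A : Matrix ι ι ℂ) (P : ℂ[X]) : Prop :=
  ∀ z : ℂ, ∀ j < (minpoly ℂ A).rootMultiplicity z,
    (Polynomial.derivative^[j] P).eval z = iteratedDeriv j f z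

theorem eval_iterate_derivative (P : ℂ[X]) (z : ℂ) (j : ℕ) :
    (Polynomial.derivative^[j] P).eval z
      = (j.factorial : ℂ) * (Polynomial.taylor z P).coeff j := by
  rw [← Polynomial.factorial_smul_hasseDeriv, Polynomial.taylor_coeff]
  simp

theorem minpoly_ne_zero {ι : Type*} [Fintype ι] [DecidableEq ι] (A : Matrix ι ι ℂ) :
    minpoly ℂ A ≠ 0 :=
  minpoly.ne_zero (Algebra.IsIntegral.isIntegral A)

/-- A Hermite interpolation polynomial exists. -/
theorem exists_hermiteInterpolates {ι : Type*} [Fintype ι] [DecidableEq ι]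
    (f : ℂ → ℂ) (A : Matrix ι ι ℂ) : ∃ P : ℂ[X], HermiteInterpolates f A P := by
  classical
  set m := minpoly ℂ A with hm
  let S := m.roots.toFinset
  let I : S → Ideal ℂ[X] := fun z =>
    Ideal.span {(Polynomial.X - Polynomial.C (z : ℂ)) ^ (m.rootMultiplicity (z : ℂ))}
  have hI : Pairwise (Function.onFun IsCoprime I) := by
    intro a b hab
    have h := Polynomial.pairwise_coprime_X_sub_C (K := ℂ) (I := S) (s := fun z => (z : ℂ))
      Subtype.val_injective hab
    exact (Ideal.isCoprime_span_singleton_iff _ _).2 (IsCoprime.pow h)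
  let L : S → ℂ[X] := fun z => Polynomial.taylor (-(z : ℂ))
    (∑ j ∈ Finset.range (m.rootMultiplicity (z : ℂ)),
      Polynomial.monomial j (iteratedDeriv j f z / (j.factorial : ℂ)))
  obtain ⟨y, hy⟩ := Ideal.quotientInfToPiQuotient_surj hI (fun z => Ideal.Quotient.mk (I z) (L z))
  obtain ⟨P, rfl⟩ := Ideal.Quotient.mk_surjective y
  refine ⟨P, ?_⟩
  intro z j hj
  have hzS : z ∈ S := by
    simp only [S, Multiset.mem_toFinset]
    rw [← Multiset.count_pos, Polynomial.count_roots]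
    exact lt_of_le_of_lt (Nat.zero_le _) hj
  have h1 := congrFun hy ⟨z, hzS⟩
  rw [Ideal.quotientInfToPiQuotient_mk'] at h1
  have h2 := Ideal.Quotient.eq.1 h1
  obtain ⟨q, hq⟩ := Ideal.mem_span_singleton'.1 h2
  have h3 : P = L ⟨z, hzS⟩ + q * (Polynomial.X - Polynomial.C z) ^ (m.rootMultiplicity z) := by
    rw [hq]; ring
  rw [eval_iterate_derivative, h3, map_add, Polynomial.taylor_mul, Polynomial.taylor_pow,
    Polynomial.coeff_add]
  have h4 : Polynomial.taylor z (Polynomial.X - Polynomial.C z) = Polynomial.X := by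
    rw [map_sub, Polynomial.taylor_X, Polynomial.taylor_C]; ring
  rw [h4, Polynomial.coeff_mul_X_pow', if_neg (not_le.2 hj)]
  simp only [L, Polynomial.taylor_taylor, add_neg_cancel, Polynomial.taylor_zero,
    Polynomial.finsetSum_coeff, Polynomial.coeff_monomial, Finset.sum_ite_eq', Finset.mem_range,
    add_zero]
  rw [if_pos (show j < m.rootMultiplicity z from hj)]
  have : (j.factorial : ℂ) ≠ 0 := by exact_mod_cast j.factorial_ne_zero
  field_simp

/-- The primary matrix function `f(A)`: the value at `A` of a Hermite interpolation polynomial of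
`f` on the spectrum of `A`. By `primaryMatrixFunction_eq` it does not depend on the choice of the
polynomial. -/
def primaryMatrixFunction {ι : Type*} [Fintype ι] [DecidableEq ι]
    (f : ℂ → ℂ) (A : Matrix ι ι ℂ) : Matrix ι ι ℂ :=
  Polynomial.aeval A (exists_hermiteInterpolates f A).choose

/-- `f(A) = P(A)` for every Hermite interpolation polynomial `P` of `f` on the spectrum of `A`. -/
theorem primaryMatrixFunction_eq {ι : Type*} [Fintype ι] [DecidableEq ι]
    (f : ℂ → ℂ) (A : Matrix ι ι ℂ) (P : ℂ[X]) (hP : HermiteInterpolates f A P) :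
    primaryMatrixFunction f A = Polynomial.aeval A P := by
  classical
  have hC := (exists_hermiteInterpolates f A).choose_spec
  unfold primaryMatrixFunction
  set P' := (exists_hermiteInterpolates f A).choose
  rw [← sub_eq_zero, ← map_sub]
  by_cases hD : P' - P = 0
  · rw [hD, map_zero]
  have hdvd : minpoly ℂ A ∣ P' - P := by
    rw [IsAlgClosed.dvd_iff_roots_le_roots (minpoly_ne_zero A) hD, Multiset.le_iff_count]
    intro z
    rw [Polynomial.count_roots, Polynomial.count_roots]
    by_contra! hlt
    refine lt_irrefl _ ((Polynomial.lt_rootMultiplicity_iff_isRoot_iterate_derivative hD).2 ?_ :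
      (P' - P).rootMultiplicity z < (P' - P).rootMultiplicity z)
    intro k hk
    have hk' := lt_of_le_of_lt hk hlt
    rw [Polynomial.iterate_derivative_sub, Polynomial.IsRoot.def, Polynomial.eval_sub,
      hC z k hk', hP z k hk', sub_self]
  obtain ⟨q, hq⟩ := hdvd
  rw [hq, map_mul, minpoly.aeval, zero_mul]

/-- The matrix gamma function. It is the standard one for matrices without eigenvalues in
`{0, -1, -2, …}`, near the spectrum of which the scalar gamma function is analytic. -/
def matrixGamma {ι : Type*} [Fintype ι] [DecidableEq ι] (A : Matrix ι ι ℂ) : Matrix ι ι ℂ :=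
  primaryMatrixFunction Complex.Gamma A

/-- The set `{0, -1, -2, …}` of poles of the gamma function. -/
def nonposIntegers : Set ℂ := {z | ∃ k : ℕ, z = -(k : ℂ)}

/-- The matrix norm `‖A‖_p` induced by the vector `p`-norm on `ℂ^ι`. -/
def matrixPNorm {ι : Type*} [Fintype ι] [DecidableEq ι] (p : ℝ≥0∞) [Fact (1 ≤ p)]
    (A : Matrix ι ι ℂ) : ℝ :=
  ‖LinearMap.toContinuousLinearMap (Matrix.toLpLin p p A)‖

/-- The `k × k` nilpotent shift block, with ones on the superdiagonal and zeros elsewhere. -/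
def shiftBlock (k : ℕ) : Matrix (Fin k) (Fin k) ℂ :=
  Matrix.of fun i j => if (i : ℕ) + 1 = (j : ℕ) then 1 else 0

/-- The block diagonal matrix `diag(N_{n 0}, …, N_{n (s - 1)})` of shift blocks, of order
`∑ i, n i`. -/
def shiftBlockDiag {s : ℕ} (n : Fin s → ℕ) :
    Matrix (Fin (∑ i, n i)) (Fin (∑ i, n i)) ℂ :=
  Matrix.reindex finSigmaFinEquiv finSigmaFinEquiv
    (Matrix.blockDiagonal' fun i => shiftBlock (n i))

/-- `ω(α) = (2α + 1) / (α² (α + 1)²) + (cosh 1 - 1) / (α + 2)²`. -/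
def omega (α : ℝ) : ℝ :=
  (2 * α + 1) / (α ^ 2 * (α + 1) ^ 2) + (Real.cosh 1 - 1) / (α + 2) ^ 2

/-- A real matrix regarded as a complex one. -/
def toComplex {ι : Type*} (R : Matrix ι ι ℝ) : Matrix ι ι ℂ := R.map Complex.ofReal

/-- The perturbation bound
`δ_p = ‖R‖_p (Γ'(Re λ + ‖M + R‖_p) + ω(Re λ + ‖M + R‖_p) + ω(Re λ - ‖M + R‖_p))`. -/
def deltaP {ι : Type*} [Fintype ι] [DecidableEq ι] (p : ℝ≥0∞) [Fact (1 ≤ p)]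
    (lam : ℂ) (M R : Matrix ι ι ℂ) : ℝ :=
  matrixPNorm p R *
    (deriv Real.Gamma (lam.re + matrixPNorm p (M + R))
      + omega (lam.re + matrixPNorm p (M + R))
      + omega (lam.re - matrixPNorm p (M + R)))

end MatGamma

end

/-! Put `r = ‖M + R‖_p` and `x = Re λ`. Since `M` has nonnegative entries, `M + R` dominates both `M
+ Q` and `M` entrywise, so both have norm at most `r`. As `r < x`, both spectra lie in a disc about
`λ` on which Γ is holomorphic, and `Γ(λ + N) = ∑ Γ⁽ᵏ⁾(λ) / k! • N ^ k` for `N = M + Q` and `N = M`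
(`tendsto_aeval_taylorPolynomial_matrixGamma`). The terms are compared by `‖a ^ k - b ^ k‖ ≤ k r ^
(k - 1) ‖a - b‖` and `|Γ⁽ᵏ⁾(λ)| ≤ ∫ |log t| ^ k t ^ (x - 1) e ^ (-t) dt`. Summing under the integral
gives `‖Q‖_p` times `∫ |log t| e ^ (r |log t|) t ^ (x - 1) e ^ (-t) dt`. Here `e ^ (r |log t|)` is
`t ^ r` for `t > 1` and `t ^ (-r)` for `t ≤ 1`, so the integral is `Γ'(x + r)` plus two integrals of
`-log t * t ^ (α - 1) e ^ (-t)` over `(0, 1]`, with `α = x ± r`. Each is strictly below `ω(α)`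
(`integral_neg_log_mul_lt_omega`), whence the strict inequality. -/

section

/-! ### Primary matrix functions as limits of polynomials -/

open Filter Topology Metric

/-- A linear map whose kernel contains that of `D` factors through `D`. -/
theorem LinearMap.exists_eq_comp_of_ker_le {K V W U : Type*} [Field K] [AddCommGroup V]
    [Module K V] [AddCommGroup W] [Module K W] [AddCommGroup U] [Module K U]
    (D : V →ₗ[K] W) (g : V →ₗ[K] U) (h : LinearMap.ker D ≤ LinearMap.ker g) :
    ∃ L : W →ₗ[K] U, g = L ∘ₗ D := by
  obtain ⟨L, hL⟩ := LinearMap.exists_extend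
    (((LinearMap.ker D).liftQ g h) ∘ₗ D.quotKerEquivRange.symm.toLinearMap)
  refine ⟨L, LinearMap.ext fun v => ?_⟩
  have h1 := LinearMap.congr_fun hL ⟨D v, LinearMap.mem_range_self D v⟩
  have h2 : D.quotKerEquivRange.symm ⟨D v, LinearMap.mem_range_self D v⟩
      = (LinearMap.ker D).mkQ v := by
    rw [LinearEquiv.symm_apply_eq]
    rfl
  simp only [LinearMap.comp_apply, Submodule.subtype_apply, LinearEquiv.coe_coe, h2] at h1
  simpa using h1.symm

/-- Locally uniform convergence of holomorphic functions implies that of all derivatives. -/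
theorem TendstoLocallyUniformlyOn.iteratedDeriv {F : ℕ → ℂ → ℂ} {f : ℂ → ℂ} {U : Set ℂ}
    (hf : TendstoLocallyUniformlyOn F f atTop U) (hF : ∀ n, DifferentiableOn ℂ (F n) U)
    (hU : IsOpen U) (j : ℕ) :
    TendstoLocallyUniformlyOn (fun n => _root_.iteratedDeriv j (F n)) (_root_.iteratedDeriv j f)
      atTop U ∧ ∀ n, DifferentiableOn ℂ (_root_.iteratedDeriv j (F n)) U := by
  induction j with
  | zero => simpa only [iteratedDeriv_zero] using ⟨hf, hF⟩
  | succ j ih =>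
    simp only [iteratedDeriv_succ]
    exact ⟨ih.1.deriv (Eventually.of_forall ih.2) hU, fun n => (ih.2 n).deriv hU⟩

theorem Polynomial.iteratedDeriv_eval (P : ℂ[X]) (j : ℕ) :
    iteratedDeriv j (fun z => P.eval z) = fun z => (derivative^[j] P).eval z := by
  induction j with
  | zero => simp
  | succ j ih =>
    rw [iteratedDeriv_succ, ih, Function.iterate_succ_apply']
    funext z
    exact Polynomial.deriv _

/-- The Taylor polynomial of `f` at `c` of degree less than `n`. -/
noncomputable def taylorPolynomial (f : ℂ → ℂ) (c : ℂ) (n : ℕ) : ℂ[X] :=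
  ∑ k ∈ Finset.range n,
    Polynomial.C (iteratedDeriv k f c / (k.factorial : ℂ)) * (Polynomial.X - Polynomial.C c) ^ k

theorem tendstoLocallyUniformlyOn_taylorPolynomial {f : ℂ → ℂ} {c : ℂ} {ρ r : ℝ} (hr : 0 < r)
    (hρ : r < ρ) (hf : DifferentiableOn ℂ f (ball c ρ)) :
    TendstoLocallyUniformlyOn (fun n z => (taylorPolynomial f c n).eval z) f atTop (ball c r) := by
  lift r to NNReal using hr.le
  have h := (hf.mono (closedBall_subset_ball hρ)).hasFPowerSeriesOnBall (by exact_mod_cast hr)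
  -- Uniqueness of power series turns the Cauchy coefficients into `f⁽ᵏ⁾(c) / k!`.
  have hp := h.hasFPowerSeriesAt.eq_formalMultilinearSeries h.analyticAt.hasFPowerSeriesAt
  have h' := h.tendstoLocallyUniformlyOn'
  rw [eball_coe] at h'
  refine h'.congr fun n z _ => ?_
  simp only [taylorPolynomial, FormalMultilinearSeries.partialSum, hp, Polynomial.eval_finsetSum]
  refine Finset.sum_congr rfl fun k _ => ?_
  simp [mul_comm]

namespace MatGamma

variable {ι : Type*} [Fintype ι] [DecidableEq ι]

/-- Both `P` and `0` interpolate the zero function on the spectrum. -/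
theorem aeval_eq_zero_of_iterate_derivative (A : Matrix ι ι ℂ) (P : ℂ[X])
    (h : ∀ z : ℂ, ∀ j < (minpoly ℂ A).rootMultiplicity z, (Polynomial.derivative^[j] P).eval z = 0) :
    Polynomial.aeval A P = 0 := by
  have h0 : ∀ j z, iteratedDeriv j (fun _ : ℂ => (0 : ℂ)) z = 0 := fun j z => by simp
  rw [← primaryMatrixFunction_eq (fun _ => 0) A P fun z j hj => by rw [h z j hj, h0],
    primaryMatrixFunction_eq (fun _ => 0) A 0 fun z j hj => by simp, map_zero]

/-- A sequence of polynomials converging locally uniformly near the spectrum of `A` to `f`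
converges to `f(A)` at `A`. -/
theorem tendsto_aeval_primaryMatrixFunction (A : Matrix ι ι ℂ) (f : ℂ → ℂ) (P : ℕ → ℂ[X])
    {U : Set ℂ} (hU : IsOpen U) (hA : ∀ z, (minpoly ℂ A).IsRoot z → z ∈ U)
    (hP : TendstoLocallyUniformlyOn (fun n z => (P n).eval z) f atTop U) :
    Tendsto (fun n => Polynomial.aeval A (P n)) atTop (𝓝 (primaryMatrixFunction f A)) := by
  classical
  let S := (minpoly ℂ A).roots.toFinset
  -- `D` records the finitely many Hermite data. Evaluation at `A` factors through it, and the
  -- factor `L` is continuous because its domain is finite-dimensional.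
  let D : ℂ[X] →ₗ[ℂ] ((Σ z : S, Fin ((minpoly ℂ A).rootMultiplicity (z : ℂ))) → ℂ) :=
    LinearMap.pi fun i => Polynomial.leval (i.1 : ℂ) ∘ₗ (Polynomial.derivative ^ (i.2 : ℕ))
  have hS : ∀ z, ∀ j < (minpoly ℂ A).rootMultiplicity z, z ∈ S := by
    intro z j hj
    simp only [S, Multiset.mem_toFinset]
    rw [← Multiset.count_pos, Polynomial.count_roots]
    exact lt_of_le_of_lt (Nat.zero_le _) hj
  have hD : ∀ Q i, D Q i = (Polynomial.derivative^[(i.2 : ℕ)] Q).eval (i.1 : ℂ) := by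
    intro Q i
    simp [D, Polynomial.leval, Module.End.pow_apply]
  obtain ⟨L, hL⟩ := LinearMap.exists_eq_comp_of_ker_le D (Polynomial.aeval A).toLinearMap (by
    intro Q hQ
    refine aeval_eq_zero_of_iterate_derivative A Q fun z j hj => ?_
    have := congrFun (LinearMap.mem_ker.1 hQ) ⟨⟨z, hS z j hj⟩, ⟨j, hj⟩⟩
    rwa [hD] at this)
  have hL' : ∀ Q, Polynomial.aeval A Q = L (D Q) := fun Q => LinearMap.congr_fun hL Q
  obtain ⟨P', hP'⟩ := exists_hermiteInterpolates f A
  rw [primaryMatrixFunction_eq f A P' hP', hL']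
  simp only [hL']
  refine (LinearMap.continuous_of_finiteDimensional L).continuousAt.tendsto.comp ?_
  refine tendsto_pi_nhds.2 fun i => ?_
  simp only [hD]
  rw [hP' _ _ i.2.2]
  have hz : (i.1 : ℂ) ∈ U := hA _ (Polynomial.isRoot_of_mem_roots (Multiset.mem_toFinset.1 i.1.2))
  have := (hP.iteratedDeriv (fun n => (P n).differentiable.differentiableOn) hU i.2).1.tendsto_at hz
  simpa only [Polynomial.iteratedDeriv_eval] using this

end MatGamma

end

/-! ### The induced norm, the spectrum and powers -/

section

open Filter Topology
namespace MatGamma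
variable {ι : Type*} [Fintype ι] [DecidableEq ι]

theorem _root_.PiLp.norm_le_norm_of_forall_le {κ : Type*} [Fintype κ] {p : ℝ≥0∞} [Fact (1 ≤ p)]
    (u v : PiLp p fun _ : κ => ℂ)
    (h : ∀ i, ‖u i‖ ≤ ‖v i‖) : ‖u‖ ≤ ‖v‖ := by
  rcases eq_or_ne p ⊤ with rfl | hp
  · rw [PiLp.norm_eq_ciSup, PiLp.norm_eq_ciSup]
    exact ciSup_mono (Set.finite_range _).bddAbove h
  · have hp0 : 0 < p.toReal := ENNReal.toReal_pos (by
      have := Fact.out (p := 1 ≤ p)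
      positivity) hp
    rw [PiLp.norm_eq_sum hp0, PiLp.norm_eq_sum hp0]
    gcongr
    exact h _

/-- The algebra homomorphism sending a matrix to the operator on `ℓ^p` that it defines. -/
noncomputable def toLpCLM (p : ℝ≥0∞) [Fact (1 ≤ p)] :
    Matrix ι ι ℂ →ₐ[ℂ] (PiLp p (fun _ : ι => ℂ) →L[ℂ] PiLp p (fun _ : ι => ℂ)) :=
  AlgHom.ofLinearMap
    (LinearMap.toContinuousLinearMap.toLinearMap ∘ₗ (Matrix.toLpLin p p).toLinearMap)
    (by ext; simp) (by intro A B; ext; simp)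

variable (p : ℝ≥0∞) [Fact (1 ≤ p)]

theorem matrixPNorm_eq (A : Matrix ι ι ℂ) : matrixPNorm p A = ‖toLpCLM p A‖ := rfl

theorem matrixPNorm_nonneg (A : Matrix ι ι ℂ) : 0 ≤ matrixPNorm p A := norm_nonneg _

theorem continuous_matrixPNorm : Continuous (matrixPNorm p : Matrix ι ι ℂ → ℝ) := by
  let L : Matrix ι ι ℂ →ₗ[ℂ] (PiLp p (fun _ : ι => ℂ) →L[ℂ] PiLp p (fun _ : ι => ℂ)) :=
    LinearMap.toContinuousLinearMap.toLinearMap ∘ₗ (Matrix.toLpLin p p).toLinearMap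
  exact (LinearMap.continuous_of_finiteDimensional L).norm

theorem matrixPNorm_pos {A : Matrix ι ι ℂ} (hA : A ≠ 0) : 0 < matrixPNorm p A := by
  refine norm_pos_iff.2 fun h => hA ?_
  rw [map_eq_zero_iff _ (LinearEquiv.injective _)] at h
  exact (map_eq_zero_iff _ (LinearEquiv.injective _)).1 h

/-- The induced `p`-norm is monotone with respect to entrywise domination. -/
theorem matrixPNorm_le_of_norm_le (A : Matrix ι ι ℂ) (B : Matrix ι ι ℝ)
    (h : ∀ i j, ‖A i j‖ ≤ B i j) : matrixPNorm p A ≤ matrixPNorm p (toComplex B) := by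
  refine ContinuousLinearMap.opNorm_le_bound _ (matrixPNorm_nonneg p _) fun v => ?_
  -- The vector of moduli has the norm of `v`, and `B w` dominates `A v` entrywise.
  let w : PiLp p (fun _ : ι => ℂ) := WithLp.toLp p fun i => (‖v i‖ : ℂ)
  have hw : ‖w‖ ≤ ‖v‖ := PiLp.norm_le_norm_of_forall_le _ _ fun i => by simp [w]
  refine (PiLp.norm_le_norm_of_forall_le _ (Matrix.toLpLin p p (toComplex B) w) fun i => ?_).trans
    ((ContinuousLinearMap.le_opNorm (LinearMap.toContinuousLinearMap
      (Matrix.toLpLin p p (toComplex B))) w).trans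
      (mul_le_mul_of_nonneg_left hw (matrixPNorm_nonneg p _)))
  have h2 : Matrix.toLpLin p p (toComplex B) w i = ((∑ j, B i j * ‖v j‖ : ℝ) : ℂ) := by
    simp [Matrix.toLpLin_apply, Matrix.mulVec, dotProduct, toComplex, w]
  have h1 : (LinearMap.toContinuousLinearMap (Matrix.toLpLin p p A)) v i = ∑ j, A i j * v j := by
    simp [Matrix.toLpLin_apply, Matrix.mulVec, dotProduct]
  rw [h1, h2]
  calc ‖∑ j, A i j * v j‖ ≤ ∑ j, B i j * ‖v j‖ := norm_sum_le_of_le _ fun j _ => by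
        rw [norm_mul]
        exact mul_le_mul_of_nonneg_right (h i j) (norm_nonneg _)
    _ ≤ _ := by
        rw [Complex.norm_real]
        exact le_abs_self _

/-- The spectrum of a matrix lies in the disc whose radius is the induced norm. -/
theorem norm_sub_le_of_mem_spectrum {lam z : ℂ} {N : Matrix ι ι ℂ}
    (hz : z ∈ spectrum ℂ (lam • (1 : Matrix ι ι ℂ) + N)) : ‖z - lam‖ ≤ matrixPNorm p N := by
  rw [← Matrix.spectrum_toLpLin p, ← Module.End.hasEigenvalue_iff_mem_spectrum] at hz
  obtain ⟨v, hv⟩ := hz.exists_hasEigenvector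
  have h1 : Matrix.toLpLin p p N v = (z - lam) • v := by
    have := hv.apply_eq_smul
    rw [map_add, LinearMap.add_apply, map_smul, Matrix.toLpLin_one] at this
    rw [sub_smul, ← this]
    simp
  have h2 := ContinuousLinearMap.le_opNorm (LinearMap.toContinuousLinearMap
    (Matrix.toLpLin p p N)) v
  rw [LinearMap.coe_toContinuousLinearMap', h1, norm_smul] at h2
  exact le_of_mul_le_mul_right h2 (norm_pos_iff.2 hv.2)

theorem disjoint_spectrum_nonposIntegers {lam : ℂ} {N : Matrix ι ι ℂ}
    (h : matrixPNorm p N < lam.re) :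
    Disjoint (spectrum ℂ (lam • (1 : Matrix ι ι ℂ) + N)) nonposIntegers := by
  rw [Set.disjoint_left]
  rintro z hz ⟨k, rfl⟩
  have h1 := (Complex.abs_re_le_norm _).trans (norm_sub_le_of_mem_spectrum p hz)
  have h2 := neg_le_of_abs_le h1
  simp only [Complex.sub_re, Complex.neg_re, Complex.natCast_re] at h2
  have : (0 : ℝ) ≤ k := k.cast_nonneg
  linarith

theorem mem_spectrum_of_isRoot_minpoly {A : Matrix ι ι ℂ} {z : ℂ} (h : (minpoly ℂ A).IsRoot z) :
    z ∈ spectrum ℂ A := by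
  rw [← Matrix.spectrum_toLin', ← Module.End.hasEigenvalue_iff_mem_spectrum,
    Module.End.hasEigenvalue_iff_isRoot, Matrix.minpoly_toLin']
  exact h

theorem _root_.norm_pow_sub_pow_le {E : Type*} [SeminormedRing E] {a b : E} {r : ℝ} (ha : ‖a‖ ≤ r)
    (hb : ‖b‖ ≤ r) (k : ℕ) : ‖a ^ k - b ^ k‖ ≤ k * r ^ (k - 1) * ‖a - b‖ := by
  have hr : 0 ≤ r := (norm_nonneg a).trans ha
  -- The exponent 0 is split off because of the truncated `k - 1` and because `‖1‖ ≤ 1` is not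
  -- available in a seminormed ring.
  rcases k with - | k
  · simp
  induction k with
  | zero => simp
  | succ k ih =>
    have h1 : a ^ (k + 2) - b ^ (k + 2) = a * (a ^ (k + 1) - b ^ (k + 1))
        + (a - b) * b ^ (k + 1) := by
      rw [pow_succ' a (k + 1), pow_succ' b (k + 1)]
      rw [mul_sub, sub_mul]
      abel
    have hbk : ‖b ^ (k + 1)‖ ≤ r ^ (k + 1) :=
      (norm_pow_le' b k.succ_pos).trans (pow_le_pow_left₀ (norm_nonneg _) hb _)
    have h2 : ‖a * (a ^ (k + 1) - b ^ (k + 1))‖ ≤ r * (((k + 1 : ℕ) : ℝ) * r ^ k * ‖a - b‖) :=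
      (norm_mul_le _ _).trans (mul_le_mul ha (by simpa using ih) (norm_nonneg _) hr)
    have h3 : ‖(a - b) * b ^ (k + 1)‖ ≤ ‖a - b‖ * r ^ (k + 1) :=
      (norm_mul_le _ _).trans (mul_le_mul_of_nonneg_left hbk (norm_nonneg _))
    rw [h1]
    refine (norm_add_le _ _).trans ((add_le_add h2 h3).trans (le_of_eq ?_))
    push_cast
    ring

end MatGamma

end

/-! ### Integral formulas for derivatives of Γ, and the bound ω -/

section

open Filter Topology MeasureTheory Set Asymptotics

namespace MatGamma

/-- The function `t ↦ (log t) ^ k * exp (-t)`, the Mellin transform of which is the `k`-th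
derivative of the gamma function. -/
noncomputable def logPowExp (k : ℕ) (t : ℝ) : ℂ := ((Real.log t ^ k * Real.exp (-t) : ℝ) : ℂ)

theorem log_smul_logPowExp (k : ℕ) :
    (fun t : ℝ => Real.log t • logPowExp k t) = logPowExp (k + 1) := by
  funext t
  simp only [logPowExp, Complex.real_smul]
  push_cast
  ring

/-- Each factor `log t` costs one unit of exponent, which the exponential decay affords for every
`a`. -/
theorem logPowExp_isBigO_atTop (k : ℕ) (a : ℝ) :
    logPowExp k =O[atTop] (fun t : ℝ => t ^ (-a)) := by
  induction k generalizing a with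
  | zero =>
    have : logPowExp 0 = fun t : ℝ => ((Real.exp (-t) : ℝ) : ℂ) := by
      funext t
      simp [logPowExp]
    rw [this, ← isBigO_norm_left]
    simp_rw [Complex.norm_real, isBigO_norm_left]
    simpa only [neg_one_mul] using (isLittleO_exp_neg_mul_rpow_atTop zero_lt_one _).isBigO
  | succ k ih =>
    rw [← log_smul_logPowExp]
    exact isBigO_rpow_top_log_smul (lt_add_one a) (ih (a + 1))

/-- Each factor `log t` is paid for with half of the remaining exponent `b`. -/
theorem logPowExp_isBigO_zero (k : ℕ) {b : ℝ} (hb : 0 < b) :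
    logPowExp k =O[𝓝[>] 0] (fun t : ℝ => t ^ (-b)) := by
  induction k generalizing b with
  | zero =>
    refine IsBigO.of_bound 1 ?_
    filter_upwards [Ioc_mem_nhdsGT (zero_lt_one' ℝ)] with t ht
    have h1 : (1 : ℝ) ≤ t ^ (-b) := Real.one_le_rpow_of_pos_of_le_one_of_nonpos ht.1 ht.2 (by linarith)
    simp only [logPowExp, pow_zero, one_mul, Complex.norm_real, Real.norm_eq_abs, Real.abs_exp]
    exact (Real.exp_le_one_iff.2 (by linarith [ht.1])).trans (h1.trans (le_abs_self _))
  | succ k ih =>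
    rw [← log_smul_logPowExp]
    exact isBigO_rpow_zero_log_smul (half_lt_self hb) (ih (half_pos hb))

theorem locallyIntegrableOn_logPowExp (k : ℕ) : LocallyIntegrableOn (logPowExp k) (Ioi 0) := by
  refine ContinuousOn.locallyIntegrableOn ?_ measurableSet_Ioi
  refine Complex.continuous_ofReal.comp_continuousOn ?_
  exact ((Real.continuousOn_log.mono fun t ht => (ne_of_gt ht)).pow k).mul (by fun_prop)

theorem mellinConvergent_logPowExp (k : ℕ) {s : ℂ} (hs : 0 < s.re) :
    MellinConvergent (logPowExp k) s :=
  mellinConvergent_of_isBigO_rpow (locallyIntegrableOn_logPowExp k)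
    (logPowExp_isBigO_atTop k (s.re + 1)) (lt_add_one _)
    (logPowExp_isBigO_zero k (half_pos hs)) (half_lt_self hs)

theorem hasDerivAt_mellin_logPowExp (k : ℕ) {s : ℂ} (hs : 0 < s.re) :
    HasDerivAt (mellin (logPowExp k)) (mellin (logPowExp (k + 1)) s) s := by
  rw [← log_smul_logPowExp]
  exact (mellin_hasDerivAt_of_isBigO_rpow (locallyIntegrableOn_logPowExp k)
    (logPowExp_isBigO_atTop k (s.re + 1)) (lt_add_one _)
    (logPowExp_isBigO_zero k (half_pos hs)) (half_lt_self hs)).2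

/-- Γ is the Mellin transform of `e ^ (-t)`, and each differentiation under the integral brings down
a factor `log t`. -/
theorem iteratedDeriv_Gamma (k : ℕ) {s : ℂ} (hs : 0 < s.re) :
    iteratedDeriv k Complex.Gamma s = mellin (logPowExp k) s := by
  induction k generalizing s with
  | zero =>
    rw [iteratedDeriv_zero, Complex.Gamma_eq_integral hs, Complex.GammaIntegral_eq_mellin]
    congr 1
    funext t
    simp [logPowExp]
  | succ k ih =>
    rw [iteratedDeriv_succ, ← (hasDerivAt_mellin_logPowExp k hs).deriv]
    refine EventuallyEq.deriv_eq ?_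
    filter_upwards [(Complex.continuous_re.isOpen_preimage _ isOpen_Ioi).mem_nhds hs] with z hz
    exact ih hz

theorem norm_cpow_smul_logPowExp (k : ℕ) (s : ℂ) {t : ℝ} (ht : 0 < t) :
    ‖(t : ℂ) ^ (s - 1) • logPowExp k t‖
      = |Real.log t| ^ k * (t ^ (s.re - 1) * Real.exp (-t)) := by
  rw [norm_smul, Complex.norm_cpow_eq_rpow_re_of_pos ht, logPowExp, Complex.norm_real,
    Real.norm_eq_abs, abs_mul, abs_pow, Real.abs_exp, Complex.sub_re, Complex.one_re]
  ring

theorem integrableOn_abs_log_pow (k : ℕ) {x : ℝ} (hx : 0 < x) :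
    IntegrableOn (fun t : ℝ => |Real.log t| ^ k * (t ^ (x - 1) * Real.exp (-t))) (Ioi 0) := by
  have h := (mellinConvergent_logPowExp k (s := (x : ℂ)) (by simpa using hx)).norm
  refine (integrableOn_congr_fun (fun t ht => ?_) measurableSet_Ioi).1 h
  have := norm_cpow_smul_logPowExp k (x : ℂ) ht
  simpa using this

theorem norm_iteratedDeriv_Gamma_le (k : ℕ) {s : ℂ} (hs : 0 < s.re) :
    ‖iteratedDeriv k Complex.Gamma s‖
      ≤ ∫ t in Ioi (0 : ℝ), |Real.log t| ^ k * (t ^ (s.re - 1) * Real.exp (-t)) := by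
  rw [iteratedDeriv_Gamma k hs, mellin]
  refine (norm_integral_le_integral_norm _).trans (le_of_eq ?_)
  exact setIntegral_congr_fun measurableSet_Ioi fun t ht => norm_cpow_smul_logPowExp k s ht

theorem integrableOn_log_mul {x : ℝ} (hx : 0 < x) :
    IntegrableOn (fun t : ℝ => Real.log t * (t ^ (x - 1) * Real.exp (-t))) (Ioi 0) := by
  refine (integrableOn_abs_log_pow 1 hx).mono' ?_ ?_
  · exact (by fun_prop : Measurable fun t : ℝ => Real.log t * (t ^ (x - 1) * Real.exp (-t))).aestronglyMeasurable
  · filter_upwards [ae_restrict_mem measurableSet_Ioi] with t ht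
    rw [norm_mul, pow_one, Real.norm_eq_abs, Real.norm_of_nonneg (by have := ht.out; positivity)]

theorem deriv_real_Gamma {x : ℝ} (hx : 0 < x) :
    deriv Real.Gamma x = ∫ t in Ioi (0 : ℝ), Real.log t * (t ^ (x - 1) * Real.exp (-t)) := by
  have hx' : 0 < (x : ℂ).re := by simpa using hx
  have h := hasDerivAt_mellin_logPowExp 0 hx'
  have h0 : HasDerivAt Complex.Gamma (mellin (logPowExp 1) x) x := by
    refine h.congr_of_eventuallyEq ?_
    filter_upwards [(Complex.continuous_re.isOpen_preimage _ isOpen_Ioi).mem_nhds hx'] with z hz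
    rw [← iteratedDeriv_Gamma 0 hz, iteratedDeriv_zero]
  have h1 : deriv Real.Gamma x = (mellin (logPowExp 1) x).re := h0.real_of_complex.deriv
  have h2 : mellin (logPowExp 1) x
      = ((∫ t in Ioi (0 : ℝ), Real.log t * (t ^ (x - 1) * Real.exp (-t)) : ℝ) : ℂ) := by
    rw [mellin, ← integral_complex_ofReal]
    refine setIntegral_congr_fun measurableSet_Ioi fun t ht => ?_
    simp only [logPowExp, smul_eq_mul]
    push_cast
    rw [Complex.ofReal_cpow (le_of_lt ht)]
    push_cast
    ring
  rw [h1, h2, Complex.ofReal_re]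

/-- `∫₀¹ (-log t) t ^ (α - 1) dt = 1 / α²`. -/
theorem integral_neg_log_mul_rpow {α : ℝ} (hα : 0 < α) :
    IntegrableOn (fun t : ℝ => -Real.log t * t ^ (α - 1)) (Ioc 0 1) ∧
    ∫ t in Ioc (0 : ℝ) 1, -Real.log t * t ^ (α - 1) = 1 / α ^ 2 := by
  -- Antiderivative from integration by parts; it extends continuously to 0 since `t ^ α log t → 0`.
  let F : ℝ → ℝ := fun t => t ^ α / α ^ 2 - Real.log t * t ^ α / α
  have hF : ∀ t ∈ Ioo (0 : ℝ) 1, HasDerivAt F (-Real.log t * t ^ (α - 1)) t := by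
    intro t ht
    have ht0 := ht.1
    have h1 := Real.hasDerivAt_rpow_const (x := t) (p := α) (Or.inl ht0.ne')
    have h2 := (h1.div_const (α ^ 2)).sub (((Real.hasDerivAt_log ht0.ne').mul h1).div_const α)
    refine h2.congr_deriv ?_
    rw [show t ^ α = t ^ (α - 1) * t by rw [← Real.rpow_add_one ht0.ne']; ring_nf]
    field_simp
    ring
  have hc : ContinuousOn F (Icc 0 1) := by
    intro t ht
    rcases eq_or_lt_of_le ht.1 with rfl | h0
    · rw [← continuousWithinAt_sdiff_self]
      have hl := tendsto_log_mul_rpow_nhdsGT_zero hα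
      have hr : Tendsto (fun t : ℝ => t ^ α) (𝓝[>] 0) (𝓝 0) := by
        have := (Real.continuousAt_rpow_const 0 α (Or.inr hα.le)).tendsto
        rw [Real.zero_rpow hα.ne'] at this
        exact this.mono_left nhdsWithin_le_nhds
      have hF0 : F 0 = 0 / α ^ 2 - 0 / α := by simp [F, Real.zero_rpow hα.ne']
      rw [ContinuousWithinAt, hF0]
      refine ((hr.div_const (α ^ 2)).sub (hl.div_const α)).mono_left (nhdsWithin_mono _ ?_)
      rintro u ⟨hu, hu'⟩
      exact lt_of_le_of_ne hu.1 (Ne.symm hu')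
    · have := h0.ne'
      have h1 : ContinuousAt F t := by
        refine ((Real.continuousAt_rpow_const t α (Or.inl this)).div_const _).sub
          (((Real.continuousAt_log this).mul
            (Real.continuousAt_rpow_const t α (Or.inl this))).div_const _)
      exact h1.continuousWithinAt
  -- A nonnegative derivative of a function continuous up to the endpoints is integrable, so the
  -- singularity at 0 needs no estimate.
  have hnn : ∀ t ∈ Ioo (0 : ℝ) 1, 0 ≤ -Real.log t * t ^ (α - 1) := fun t ht =>
    mul_nonneg (neg_nonneg.2 (Real.log_nonpos ht.1.le ht.2.le)) (Real.rpow_nonneg ht.1.le _)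
  have hi := intervalIntegral.integrableOn_deriv_of_nonneg hc hF hnn
  refine ⟨hi, ?_⟩
  rw [← intervalIntegral.integral_of_le zero_le_one,
    intervalIntegral.integral_eq_sub_of_hasDerivAt_of_le zero_le_one hc hF
      ((intervalIntegrable_iff_integrableOn_Ioc_of_le zero_le_one).2 hi)]
  simp [F, Real.zero_rpow hα.ne']

/-- The difference of the two sides vanishes at 0 and has derivative `e ^ (-t) - (1 - t) ≥ 0`. -/
theorem exp_neg_le_quadratic {t : ℝ} (ht : 0 ≤ t) : Real.exp (-t) ≤ 1 - t + t ^ 2 / 2 := by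
  have h : MonotoneOn (fun t : ℝ => 1 - t + t ^ 2 / 2 - Real.exp (-t)) (Ici 0) := by
    have hd : ∀ t : ℝ, HasDerivAt (fun t : ℝ => 1 - t + t ^ 2 / 2 - Real.exp (-t))
        (-1 + t + Real.exp (-t)) t := by
      intro t
      have h1 := (((hasDerivAt_id t).const_sub 1).add (((hasDerivAt_id t).pow 2).div_const 2)).sub
        ((hasDerivAt_id t).neg.exp)
      refine h1.congr_deriv ?_
      simp
    refine monotoneOn_of_deriv_nonneg (convex_Ici 0)
      (fun t _ => (hd t).continuousAt.continuousWithinAt)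
      (fun t _ => (hd t).differentiableAt.differentiableWithinAt) fun t _ => ?_
    rw [(hd t).deriv]
    linarith [Real.add_one_le_exp (-t)]
  have := h (mem_Ici.2 le_rfl) (mem_Ici.2 ht) ht
  simp at this
  linarith

theorem half_lt_cosh_one_sub_one : 1 / 2 < Real.cosh 1 - 1 := by
  rw [Real.cosh_eq]
  have h1 := Real.exp_one_gt_d9
  have h2 := Real.exp_neg_one_gt_d9
  linarith

/-- The quadratic bound on `e ^ (-t)` reduces this to three integrals with values `1 / α²`, `1 / (α
+ 1)²`, `1 / (α + 2)²`. Strictness comes only from `1 / 2 < cosh 1 - 1`. -/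
theorem integral_neg_log_mul_lt_omega {α : ℝ} (hα : 0 < α) :
    ∫ t in Ioc (0 : ℝ) 1, -(Real.log t * (t ^ (α - 1) * Real.exp (-t))) < omega α := by
  obtain ⟨i0, e0⟩ := integral_neg_log_mul_rpow hα
  obtain ⟨i1, e1⟩ := integral_neg_log_mul_rpow (show 0 < α + 1 by linarith)
  obtain ⟨i2, e2⟩ := integral_neg_log_mul_rpow (show 0 < α + 2 by linarith)
  have i01 : IntegrableOn (fun t : ℝ => -Real.log t * t ^ (α - 1) - -Real.log t * t ^ (α + 1 - 1))
    (Ioc 0 1) := i0.sub i1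
  have i2' : IntegrableOn (fun t : ℝ => -Real.log t * t ^ (α + 2 - 1) / 2) (Ioc 0 1) :=
    i2.div_const 2
  have hint : IntegrableOn (fun t : ℝ => -(Real.log t * (t ^ (α - 1) * Real.exp (-t))))
      (Ioc 0 1) := ((integrableOn_log_mul hα).mono_set Ioc_subset_Ioi_self).neg
  have hle : ∫ t in Ioc (0 : ℝ) 1, -(Real.log t * (t ^ (α - 1) * Real.exp (-t)))
      ≤ 1 / α ^ 2 - 1 / (α + 1) ^ 2 + 1 / (α + 2) ^ 2 / 2 := by
    rw [← e0, ← e1, ← e2, ← integral_div, ← integral_sub i0 i1,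
      ← integral_add i01 i2']
    refine setIntegral_mono_on hint (i01.add i2') measurableSet_Ioc
      fun t ht => ?_
    have ht0 := ht.1
    have h1 : t ^ (α + 1 - 1) = t ^ (α - 1) * t := by
      rw [← Real.rpow_add_one ht0.ne']
      ring_nf
    have h2 : t ^ (α + 2 - 1) = t ^ (α - 1) * t ^ 2 := by
      rw [← Real.rpow_add_natCast ht0.ne']
      push_cast
      ring_nf
    rw [h1, h2]
    have h3 : 0 ≤ -Real.log t * t ^ (α - 1) :=
      mul_nonneg (neg_nonneg.2 (Real.log_nonpos ht.1.le ht.2)) (Real.rpow_nonneg ht.1.le _)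
    have h4 := mul_le_mul_of_nonneg_left (exp_neg_le_quadratic ht0.le) h3
    linear_combination h4
  refine hle.trans_lt ?_
  have h1 : 1 / α ^ 2 - 1 / (α + 1) ^ 2 = (2 * α + 1) / (α ^ 2 * (α + 1) ^ 2) := by
    field_simp
    ring
  rw [h1, omega]
  have h2 : 1 / (α + 2) ^ 2 / 2 = (1 / 2) / (α + 2) ^ 2 := by ring
  rw [h2]
  have := div_lt_div_of_pos_right half_lt_cosh_one_sub_one (show 0 < (α + 2) ^ 2 by positivity)
  linarith

end MatGamma

end

/-! ### Summing the Taylor series and the general perturbation bound -/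

section

open Filter Topology MeasureTheory Set

namespace MatGamma

/-- The term `k = 0` vanishes and `k / k! = 1 / (k - 1)!`, so this is `u` times a partial sum of `e
^ (r u)`. -/
theorem sum_mul_pow_le_mul_exp {r u : ℝ} (hr : 0 ≤ r) (hu : 0 ≤ u) (n : ℕ) :
    ∑ k ∈ Finset.range n, (k * r ^ (k - 1) / (k.factorial : ℝ)) * u ^ k ≤ u * Real.exp (r * u) := by
  rcases n with - | n
  · simp only [Finset.range_zero, Finset.sum_empty]
    positivity
  rw [Finset.sum_range_succ']
  have h := mul_le_mul_of_nonneg_left (Real.sum_le_exp_of_nonneg (mul_nonneg hr hu) n) hu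
  refine le_trans (le_of_eq ?_) h
  rw [Finset.mul_sum]
  simp only [Nat.cast_zero, zero_mul, zero_div, add_zero]
  refine Finset.sum_congr rfl fun k _ => ?_
  rw [Nat.factorial_succ]
  have : (k.factorial : ℝ) ≠ 0 := by exact_mod_cast k.factorial_ne_zero
  push_cast
  field_simp
  ring

/-- The partial sums of `∑ k r ^ (k - 1) / k! * ∫ |log t| ^ k t ^ (x - 1) exp (-t) dt` stay below
a constant smaller than `Γ'(x + r) + ω(x + r) + ω(x - r)`. -/
theorem exists_sum_integral_abs_log_pow_le {x r : ℝ} (hr : 0 ≤ r) (hx : r < x) :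
    ∃ C < deriv Real.Gamma (x + r) + omega (x + r) + omega (x - r), ∀ n,
      ∑ k ∈ Finset.range n, (k * r ^ (k - 1) / (k.factorial : ℝ)) *
        ∫ t in Ioi (0 : ℝ), |Real.log t| ^ k * (t ^ (x - 1) * Real.exp (-t)) ≤ C := by
  have hx0 : 0 < x := hr.trans_lt hx
  have hy : 0 < x + r := by linarith
  have ha : 0 < x - r := by linarith
  let h : ℝ → ℝ → ℝ := fun s t => Real.log t * (t ^ (s - 1) * Real.exp (-t))
  have hint : ∀ s, 0 < s → IntegrableOn
      ((Ioc 0 1).indicator fun t => -h s t) (Ioi 0) := fun s hs =>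
    (integrableOn_log_mul hs).neg.indicator measurableSet_Ioc
  have hind : ∀ s, 0 < s → ∫ t in Ioi (0 : ℝ), (Ioc 0 1).indicator (fun t => -h s t) t < omega s := by
    intro s hs
    rw [setIntegral_indicator measurableSet_Ioc, inter_eq_right.2 Ioc_subset_Ioi_self]
    exact integral_neg_log_mul_lt_omega hs
  have hiy : IntegrableOn (h (x + r)) (Ioi 0) := integrableOn_log_mul hy
  have hi1 : IntegrableOn (fun t => h (x + r) t + (Ioc 0 1).indicator (fun t => -h (x + r) t) t)
    (Ioi 0) := hiy.add (hint _ hy)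
  have hi2 : IntegrableOn (fun t => h (x + r) t + (Ioc 0 1).indicator (fun t => -h (x + r) t) t
      + (Ioc 0 1).indicator (fun t => -h (x - r) t) t) (Ioi 0) := hi1.add (hint _ ha)
  -- The integrand is `|log t| e ^ (r |log t|) t ^ (x - 1) e ^ (-t)`: on `(0, 1]` the first
  -- indicator cancels `h (x + r)` and the second supplies the exponent `x - r`.
  refine ⟨∫ t in Ioi (0 : ℝ), (h (x + r) t + (Ioc 0 1).indicator (fun t => -h (x + r) t) t
        + (Ioc 0 1).indicator (fun t => -h (x - r) t) t), ?_, fun n => ?_⟩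
  · rw [integral_add hi1 (hint _ ha), integral_add hiy (hint _ hy), deriv_real_Gamma hy]
    exact add_lt_add (add_lt_add_of_le_of_lt le_rfl (hind _ hy)) (hind _ ha)
  have hsum : ∀ k ∈ Finset.range n, IntegrableOn (fun t : ℝ => (k * r ^ (k - 1) / (k.factorial : ℝ)) *
      (|Real.log t| ^ k * (t ^ (x - 1) * Real.exp (-t)))) (Ioi 0) := fun k _ =>
    (integrableOn_abs_log_pow k hx0).const_mul _
  simp_rw [← integral_const_mul]
  rw [← integral_finsetSum _ hsum]
  refine setIntegral_mono_on (integrable_finsetSum _ hsum) hi2 measurableSet_Ioi fun t ht => ?_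
  have ht0 : 0 < t := ht
  have h1 := mul_le_mul_of_nonneg_right (sum_mul_pow_le_mul_exp hr (abs_nonneg (Real.log t)) n)
    (show 0 ≤ t ^ (x - 1) * Real.exp (-t) by positivity)
  rw [Finset.sum_mul] at h1
  simp only [mul_assoc] at h1 ⊢
  refine h1.trans (le_of_eq ?_)
  rcases le_or_gt t 1 with ht1 | ht1
  · have hm : t ∈ Ioc (0 : ℝ) 1 := ⟨ht0, ht1⟩
    rw [indicator_of_mem hm, indicator_of_mem hm, abs_of_nonpos (Real.log_nonpos ht0.le ht1)]
    have : t ^ (x - r - 1) = Real.exp (r * -Real.log t) * t ^ (x - 1) := by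
      rw [Real.rpow_def_of_pos ht0, Real.rpow_def_of_pos ht0, ← Real.exp_add]
      ring_nf
    simp only [h, this]
    ring
  · have hm : t ∉ Ioc (0 : ℝ) 1 := fun hm => absurd hm.2 (not_le.2 ht1)
    rw [indicator_of_notMem hm, indicator_of_notMem hm, abs_of_pos (Real.log_pos ht1)]
    have : t ^ (x + r - 1) = Real.exp (r * Real.log t) * t ^ (x - 1) := by
      rw [Real.rpow_def_of_pos ht0, Real.rpow_def_of_pos ht0, ← Real.exp_add]
      ring_nf
    simp only [h, this]
    ring

variable {ι : Type*} [Fintype ι] [DecidableEq ι]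

/-- Every pole has real part at most 0, hence distance at least `Re λ` from `λ`. -/
theorem differentiableOn_Gamma_ball (lam : ℂ) :
    DifferentiableOn ℂ Complex.Gamma (Metric.ball lam lam.re) := by
  intro z hz
  refine (Complex.differentiableAt_Gamma z ?_).differentiableWithinAt
  rintro m rfl
  rw [mem_ball_iff_norm] at hz
  have h1 := neg_le_of_abs_le (Complex.abs_re_le_norm (-(m : ℂ) - lam))
  simp only [Complex.sub_re, Complex.neg_re, Complex.natCast_re] at h1
  have : (0 : ℝ) ≤ m := m.cast_nonneg
  linarith

theorem aeval_taylorPolynomial (f : ℂ → ℂ) (lam : ℂ) (N : Matrix ι ι ℂ) (n : ℕ) :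
    Polynomial.aeval (lam • (1 : Matrix ι ι ℂ) + N) (taylorPolynomial f lam n)
      = ∑ k ∈ Finset.range n, (iteratedDeriv k f lam / (k.factorial : ℂ)) • N ^ k := by
  simp only [taylorPolynomial, map_sum, map_mul, map_pow, map_sub, Polynomial.aeval_X,
    Polynomial.aeval_C, Algebra.algebraMap_eq_smul_one, add_sub_cancel_left, smul_mul_assoc, one_mul]

/-- The matrix gamma function is the sum of its Taylor series. -/
theorem tendsto_aeval_taylorPolynomial_matrixGamma (p : ℝ≥0∞) [Fact (1 ≤ p)] {lam : ℂ}
    {N : Matrix ι ι ℂ} (hN : matrixPNorm p N < lam.re) :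
    Tendsto (fun n => Polynomial.aeval (lam • (1 : Matrix ι ι ℂ) + N)
      (taylorPolynomial Complex.Gamma lam n)) atTop
      (𝓝 (matrixGamma (lam • (1 : Matrix ι ι ℂ) + N))) := by
  -- The gap leaves room for an open disc that contains the spectrum and on which the Taylor series
  -- converges locally uniformly.
  obtain ⟨ρ, h1, h2⟩ := exists_between hN
  refine tendsto_aeval_primaryMatrixFunction _ _ _ (U := Metric.ball lam ρ) Metric.isOpen_ball ?_
    (tendstoLocallyUniformlyOn_taylorPolynomial ((matrixPNorm_nonneg p N).trans_lt h1) h2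
      (differentiableOn_Gamma_ball lam))
  intro z hz
  rw [mem_ball_iff_norm]
  exact (norm_sub_le_of_mem_spectrum p (mem_spectrum_of_isRoot_minpoly hz)).trans_lt h1

theorem matrixPNorm_aeval_taylorPolynomial_sub_le (p : ℝ≥0∞) [Fact (1 ≤ p)] {lam : ℂ}
    {N₁ N₂ : Matrix ι ι ℂ} {r : ℝ} (h₁ : matrixPNorm p N₁ ≤ r) (h₂ : matrixPNorm p N₂ ≤ r)
    (hr : r < lam.re) (n : ℕ) :
    matrixPNorm p (Polynomial.aeval (lam • (1 : Matrix ι ι ℂ) + N₁)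
        (taylorPolynomial Complex.Gamma lam n)
      - Polynomial.aeval (lam • (1 : Matrix ι ι ℂ) + N₂) (taylorPolynomial Complex.Gamma lam n))
    ≤ matrixPNorm p (N₁ - N₂) * ∑ k ∈ Finset.range n, (k * r ^ (k - 1) / (k.factorial : ℝ)) *
        ∫ t in Ioi (0 : ℝ), |Real.log t| ^ k * (t ^ (lam.re - 1) * Real.exp (-t)) := by
  have hr0 : 0 ≤ r := (matrixPNorm_nonneg p N₁).trans h₁
  rw [aeval_taylorPolynomial, aeval_taylorPolynomial, ← Finset.sum_sub_distrib, matrixPNorm_eq,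
    map_sum, Finset.mul_sum]
  refine norm_sum_le_of_le _ fun k _ => ?_
  rw [← smul_sub, map_smul, norm_smul, map_sub, map_pow, map_pow, norm_div, Complex.norm_natCast]
  have hk := norm_pow_sub_pow_le (a := toLpCLM p N₁) (b := toLpCLM p N₂) h₁ h₂ k
  rw [← map_sub, ← matrixPNorm_eq] at hk
  have hG := norm_iteratedDeriv_Gamma_le k (hr0.trans_lt hr)
  refine (mul_le_mul (div_le_div_of_nonneg_right hG (Nat.cast_nonneg _)) hk (norm_nonneg _)
    (div_nonneg ((norm_nonneg _).trans hG) (Nat.cast_nonneg _))).trans (le_of_eq ?_)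
  ring

/-- Perturbation bound for the matrix gamma function, with a constant that depends only on `λ` and
on a bound `r` of the norms. -/
theorem exists_matrixPNorm_matrixGamma_sub_le (p : ℝ≥0∞) [Fact (1 ≤ p)] {lam : ℂ}
    {N₁ N₂ : Matrix ι ι ℂ} {r : ℝ} (h₁ : matrixPNorm p N₁ ≤ r) (h₂ : matrixPNorm p N₂ ≤ r)
    (hr : r < lam.re) :
    ∃ C ≥ 0, C < deriv Real.Gamma (lam.re + r) + omega (lam.re + r) + omega (lam.re - r) ∧
      matrixPNorm p (matrixGamma (lam • (1 : Matrix ι ι ℂ) + N₁)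
        - matrixGamma (lam • (1 : Matrix ι ι ℂ) + N₂)) ≤ matrixPNorm p (N₁ - N₂) * C := by
  have hr0 : 0 ≤ r := (matrixPNorm_nonneg p N₁).trans h₁
  obtain ⟨C, hC, hn⟩ := exists_sum_integral_abs_log_pow_le hr0 hr
  -- Nonnegativity of `C` is the case of the empty sum.
  refine ⟨C, by simpa using hn 0, hC, ?_⟩
  have ht := ((continuous_matrixPNorm p).tendsto _).comp
    ((tendsto_aeval_taylorPolynomial_matrixGamma p (h₁.trans_lt hr)).sub
      (tendsto_aeval_taylorPolynomial_matrixGamma p (h₂.trans_lt hr)))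
  refine le_of_tendsto ht (Eventually.of_forall fun n => ?_)
  exact (matrixPNorm_aeval_taylorPolynomial_sub_le p h₁ h₂ hr n).trans
    (mul_le_mul_of_nonneg_left (hn n) (matrixPNorm_nonneg p _))

theorem shiftBlockDiag_eq_zero_or_one {s : ℕ} (n : Fin s → ℕ) (i j : Fin (∑ i, n i)) :
    shiftBlockDiag n i j = 0 ∨ shiftBlockDiag n i j = 1 := by
  simp only [shiftBlockDiag, Matrix.reindex_apply, Matrix.submatrix_apply,
    Matrix.blockDiagonal'_apply, shiftBlock, Matrix.of_apply]
  split_ifs <;> simp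

end MatGamma

end

/-! ### The theorem -/

open MatGamma in
theorem theorem5p2
    (p : ℝ≥0∞) [Fact (1 ≤ p)] (hp : p = ⊤ ∨ ∃ k : ℕ, p = (k : ℝ≥0∞))
    (s : ℕ) (hs : 0 < s) (n : Fin s → ℕ) (hn : ∀ i, 0 < n i)
    (lam : ℂ)
    (M : Matrix (Fin (∑ i, n i)) (Fin (∑ i, n i)) ℂ) (hM : M = shiftBlockDiag n)
    (Q : Matrix (Fin (∑ i, n i)) (Fin (∑ i, n i)) ℂ)
    (R : Matrix (Fin (∑ i, n i)) (Fin (∑ i, n i)) ℝ)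
    (hR : ∀ i j, 0 ≤ R i j)
    (hQR : ∀ i j, ‖Q i j‖ ≤ R i j)
    (hpos : 0 < lam.re - matrixPNorm p (M + toComplex R)) :
    Disjoint (spectrum ℂ (lam • (1 : Matrix _ _ ℂ) + M + Q)) nonposIntegers ∧
    Disjoint (spectrum ℂ (lam • (1 : Matrix _ _ ℂ) + M)) nonposIntegers ∧
    matrixPNorm p (matrixGamma (lam • (1 : Matrix _ _ ℂ) + M + Q)
        - matrixGamma (lam • (1 : Matrix _ _ ℂ) + M))
      ≤ deltaP p lam M (toComplex R) ∧
    (R ≠ 0 →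
      matrixPNorm p (matrixGamma (lam • (1 : Matrix _ _ ℂ) + M + Q)
          - matrixGamma (lam • (1 : Matrix _ _ ℂ) + M))
        < deltaP p lam M (toComplex R)) := by
  have hMnn : ∀ i j, M i j = ((‖M i j‖ : ℝ) : ℂ) := by
    intro i j
    rcases shiftBlockDiag_eq_zero_or_one n i j with h | h <;> rw [hM, h] <;> simp
  -- `M` equals its entrywise modulus, so `M + R` is a real nonnegative matrix to which monotonicity
  -- of the norm applies.
  have hMR : M + toComplex R = toComplex (Matrix.of fun i j => ‖M i j‖ + R i j) := by
    ext i j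
    simp only [Matrix.add_apply, toComplex, Matrix.map_apply, Matrix.of_apply, Complex.ofReal_add]
    rw [← hMnn]
  have h1 : matrixPNorm p (M + Q) ≤ matrixPNorm p (M + toComplex R) := by
    rw [hMR]
    refine matrixPNorm_le_of_norm_le p _ _ fun i j => ?_
    exact (norm_add_le _ _).trans (by simpa using hQR i j)
  have h2 : matrixPNorm p M ≤ matrixPNorm p (M + toComplex R) := by
    rw [hMR]
    refine matrixPNorm_le_of_norm_le p _ _ fun i j => ?_
    simpa using hR i j
  have h3 : matrixPNorm p Q ≤ matrixPNorm p (toComplex R) := matrixPNorm_le_of_norm_le p _ _ hQR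
  have hr : matrixPNorm p (M + toComplex R) < lam.re := by linarith
  obtain ⟨C, hC0, hC, hle⟩ := exists_matrixPNorm_matrixGamma_sub_le p h1 h2 hr
  rw [add_sub_cancel_left] at hle
  have hle' := hle.trans (mul_le_mul_of_nonneg_right h3 hC0)
  rw [add_assoc]
  refine ⟨disjoint_spectrum_nonposIntegers p (h1.trans_lt hr),
    disjoint_spectrum_nonposIntegers p (h2.trans_lt hr),
    hle'.trans (mul_le_mul_of_nonneg_left hC.le (matrixPNorm_nonneg p _)), fun hR0 => ?_⟩
  -- The gap between `C` and the bracket in `δ_p` survives multiplication because `‖R‖_p > 0`.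
  refine hle'.trans_lt (mul_lt_mul_of_pos_left hC (matrixPNorm_pos p fun h => hR0 ?_))
  ext i j
  simpa [toComplex] using congrFun (congrFun h i) j
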